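/- Let $d\in\mathbb N$ and let $U\colon\mathbb R^d\to\mathbb R$ satisfy: (i) $U$ is of class $C^1$, $\inf U>-\infty$, and the set $\{x : U(x)=\inf U\}$ of global minimizers is non-empty and compact; (ii) there are $\alpha>0$, $R>0$ such that $U(x)\ge\alpha|x|^2$ whenever $|x|>R$; (iii) there are $\alpha>0$, $R>0$ such that $\langle\nabla U(x),x\rangle\ge\alpha|x|^2$ whenever $|x|>R$. For $\beta\colon[0,T]\to(0,\infty)$ let $\mu_t$ be the Gibbs measure $\mu_t(dx)=Z_t^{-1}e^{-\beta(t)U(x)}\,dx$ with $Z_t=\int_{\mathbb R^d}e^{-\beta(t)U(y)}\,dy$. For a probability measure $\mu$ on $\mathbb R^d$ define its Poincaré constant $$C_P(\mu)=\inf\Big\{C\ge 0:\ \mathrm{Var}_\mu(f)\le C\int|\nabla f|^2\,d\mu\ \text{ for all } f\in C_c^\infty(\mathbb R^d)\Big\}\in[0,\infty],$$ where $\mathrm{Var}_\mu(f)=\int\big(f-\int f\,d\mu\big)^2d\mu$. Then: 1. For every $\beta\colon[0,T]\to(0,\infty)$ and every $t\in[0,T]$, $\mu_t$ is a well-defined probability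 measure, $C_P(\mu_t)<\infty$, and $$\mathrm{Var}_{\mu_t}(f)\le C_P(\mu_t)\int|\nabla f|^2\,d\mu_t\qquad\text{for all } f\in C_c^\infty(\mathbb R^d).$$ 2. For every $\beta_0>0$ there exist constants $A,B,K>0$, depending only on $U$ and $\beta_0$, such that for every $T$, every $\beta\colon[0,T]\to[\beta_0,\infty)$ and every $t\in[0,T]$, $$C_P(\mu_t)\le A\big(1+Be^{K\beta(t)}\big).$$ In particular, for any given $\beta\colon[0,T]\to(0,\infty)$ that is bounded away from $0$ (for instance continuous, non-decreasing, or with values in $[1,\infty)$), such a bound holds for all $t\in[0,T]$ with constants independent of $t$. -/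

import Mathlib

open MeasureTheory ProbabilityTheory
open scoped ContDiff NNReal ENNReal Gradient

/-- `U` is of class `C¹`, bounded below, and its set of global minimizers is non-empty and
compact. (The normalization `min U = 0`, which is made without loss of generality, is not
imposed.) -/
structure HasCompactMinimizers {d : ℕ} (U : EuclideanSpace ℝ (Fin d) → ℝ) : Prop where
  contDiff : ContDiff ℝ 1 U
  bddBelow : BddBelow (Set.range U)
  nonempty_minimizers : {x | U x = ⨅ y, U y}.Nonempty
  isCompact_minimizers : IsCompact {x | U x = ⨅ y, U y}

/-- Quadratic tail: `U x ≥ α |x|²` outside some ball. -/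
def HasQuadraticTail {d : ℕ} (U : EuclideanSpace ℝ (Fin d) → ℝ) : Prop :=
  ∃ α > 0, ∃ R > 0, ∀ x : EuclideanSpace ℝ (Fin d), R < ‖x‖ → α * ‖x‖ ^ 2 ≤ U x

/-- Quadratic growth of the radial part of the gradient: `⟨∇U(x), x⟩ ≥ α |x|²` outside some
ball. -/
def HasQuadraticGradient {d : ℕ} (U : EuclideanSpace ℝ (Fin d) → ℝ) : Prop :=
  ∃ α > 0, ∃ R > 0, ∀ x : EuclideanSpace ℝ (Fin d), R < ‖x‖ → α * ‖x‖ ^ 2 ≤ inner ℝ (∇ U x) x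

/-- The Gibbs measure with Lebesgue density `exp (-b U(x)) / ∫ exp (-b U(y)) dy`. -/
noncomputable def gibbsMeasure {d : ℕ} (U : EuclideanSpace ℝ (Fin d) → ℝ) (b : ℝ) :
    Measure (EuclideanSpace ℝ (Fin d)) :=
  (volume : Measure (EuclideanSpace ℝ (Fin d))).tilted (fun x => -b * U x)

/-- `μ` satisfies the Poincaré inequality `Var_μ(f) ≤ C ∫ |∇f|² dμ` for all smooth compactly
supported `f`. -/
def SatisfiesPoincare {d : ℕ} (μ : Measure (EuclideanSpace ℝ (Fin d))) (C : ℝ) : Prop :=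
  ∀ f : EuclideanSpace ℝ (Fin d) → ℝ, ContDiff ℝ ∞ f → HasCompactSupport f →
    Var[f; μ] ≤ C * ∫ x, ‖∇ f x‖ ^ 2 ∂μ

/-- The Poincaré constant of `μ`: the infimum, in `[0, ∞]`, of all real `C ≥ 0` for which `μ`
satisfies the Poincaré inequality (so it is `∞` if there is no such `C`). -/
noncomputable def poincareConst {d : ℕ} (μ : Measure (EuclideanSpace ℝ (Fin d))) : ℝ≥0∞ :=
  ⨅ (C : ℝ≥0) (_ : SatisfiesPoincare μ C), (C : ℝ≥0∞)

/-! A Lyapunov argument reduces the Poincaré inequality to one on a fixed ball. Applying the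
divergence theorem to the field `g² e^{-bU} x` gives an identity in which the confining term `b g²
⟨∇U, x⟩` is at least `b α g² |x|²` far out. It beats the dimension term and, after Young's
inequality, the cross term `2 g ⟨∇g, x⟩`. Hence `∫ g² dμ` is bounded by `∫ |∇g|² dμ` plus `∫_B g²
dμ`, with a ball `B` and constants uniform in `b ≥ β₀` (`exists_integral_sq_le`). Truncation allows
`g = f - c` (`exists_integral_sq_sub_le`).

On `B`, the Poincaré inequality for Lebesgue measure (`exists_setLIntegral_sq_sub_le`) supplies a
good `c`. Passing to the Gibbs measure and back costs a factor `e^{bM}` each way, with `M` bounding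
`|U|` on `B`, while the normalization cancels. This is the sole source of the exponential factor.
Finally `Var f ≤ ∫ (f - c)² dμ` for every `c`. -/

/-- The Cauchy–Schwarz inequality `(∫₀¹ h)² ≤ ∫₀¹ h²`. -/
lemma sq_intervalIntegral_le {h : ℝ → ℝ} (hc : Continuous h) :
    (∫ s in (0 : ℝ)..1, h s) ^ 2 ≤ ∫ s in (0 : ℝ)..1, h s ^ 2 := by
  set I := ∫ s in (0 : ℝ)..1, h s with hI
  have h0 : 0 ≤ ∫ s in (0 : ℝ)..1, (h s - I) ^ 2 :=
    intervalIntegral.integral_nonneg zero_le_one fun s _ => sq_nonneg _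
  have h1 : ∫ s in (0 : ℝ)..1, (h s - I) ^ 2
      = (∫ s in (0 : ℝ)..1, h s ^ 2) - 2 * I * I + I ^ 2 := by
    have : ∀ s, (h s - I) ^ 2 = h s ^ 2 - 2 * I * h s + I ^ 2 := fun s => by ring
    simp_rw [this]
    rw [intervalIntegral.integral_add, intervalIntegral.integral_sub,
      intervalIntegral.integral_const_mul, ← hI]
    · simp
    all_goals exact Continuous.intervalIntegrable (by fun_prop) _ _
  nlinarith

/-! ### Poincaré inequality for Haar measure on bounded convex sets. -/

section ConvexPoincare

variable {E : Type*} [NormedAddCommGroup E] [NormedSpace ℝ E]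

/-- Along the first half of a segment, the squared increment of `f` is controlled by the integral
of the squared derivative. -/
lemma sq_sub_midpoint_le {f : E → ℝ} (hf : ContDiff ℝ 1 f) (x y : E) :
    (f x - f ((1 / 2 : ℝ) • x + (1 / 2 : ℝ) • y)) ^ 2 ≤
      (‖y - x‖ / 2) ^ 2 *
        ∫ s in (0 : ℝ)..1, ‖fderiv ℝ f ((1 - s / 2) • x + (s / 2) • y)‖ ^ 2 := by
  have hf' : Continuous (fderiv ℝ f) := hf.continuous_fderiv one_ne_zero
  have hderiv : ∀ s : ℝ, HasDerivAt (fun s : ℝ => f ((1 - s / 2) • x + (s / 2) • y))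
      (fderiv ℝ f ((1 - s / 2) • x + (s / 2) • y) ((1 / 2 : ℝ) • (y - x))) s := by
    intro s
    have h1 : HasDerivAt (fun s : ℝ => (1 - s / 2) • x + (s / 2) • y)
        ((1 / 2 : ℝ) • (y - x)) s := by
      have ha : HasDerivAt (fun s : ℝ => 1 - s / 2) (-(1 / 2)) s :=
        ((hasDerivAt_id s).div_const 2).const_sub 1
      have hb : HasDerivAt (fun s : ℝ => s / 2) (1 / 2) s := (hasDerivAt_id s).div_const 2
      exact ((ha.smul_const x).fun_add (hb.smul_const y)).congr_deriv (by module)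
    exact ((hf.differentiable one_ne_zero _).hasFDerivAt).comp_hasDerivAt s h1
  have hcont : Continuous fun s : ℝ =>
      fderiv ℝ f ((1 - s / 2) • x + (s / 2) • y) ((1 / 2 : ℝ) • (y - x)) :=
    (hf'.comp (by fun_prop)).clm_apply continuous_const
  have hcont2 : Continuous fun s : ℝ => ‖fderiv ℝ f ((1 - s / 2) • x + (s / 2) • y)‖ ^ 2 :=
    (hf'.comp (by fun_prop)).norm.pow 2
  have hftc := intervalIntegral.integral_eq_sub_of_hasDerivAt (a := 0) (b := 1)
    (fun s _ => hderiv s) (hcont.intervalIntegrable _ _)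
  have key := sq_intervalIntegral_le hcont
  rw [hftc] at key
  have e1 : (1 - (1 : ℝ) / 2) = 1 / 2 := by norm_num
  simp only [zero_div, sub_zero, one_smul, zero_smul, add_zero, e1] at key
  calc _ = (f ((1 / 2 : ℝ) • x + (1 / 2 : ℝ) • y) - f x) ^ 2 := by ring
    _ ≤ _ := key
    _ ≤ ∫ s in (0 : ℝ)..1, (‖y - x‖ / 2) ^ 2 *
          ‖fderiv ℝ f ((1 - s / 2) • x + (s / 2) • y)‖ ^ 2 := by
      refine intervalIntegral.integral_mono_on zero_le_one
        ((hcont.pow 2).intervalIntegrable _ _)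
        ((hcont2.const_mul _).intervalIntegrable _ _) fun s _ => ?_
      rw [← mul_pow, ← sq_abs, ← Real.norm_eq_abs]
      refine pow_le_pow_left₀ (norm_nonneg _) ?_ 2
      refine (ContinuousLinearMap.le_opNorm _ _).trans (le_of_eq ?_)
      rw [norm_smul, Real.norm_of_nonneg (by norm_num)]
      ring
    _ = _ := intervalIntegral.integral_const_mul _ _

variable [FiniteDimensional ℝ E] [MeasurableSpace E] [BorelSpace E]
  {μ : Measure E} [μ.IsAddHaarMeasure]

/-- The contraction `x ↦ r x + (1 - r) y` of a convex set towards one of its points increases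
integrals at most by the factor `r ^ (- dim)`. -/
lemma setLIntegral_comp_contraction_le {K : Set E} (hK : Convex ℝ K) (hKm : MeasurableSet K)
    {G : E → ℝ≥0∞} (hG : Measurable G) {y : E} (hy : y ∈ K) {s : ℝ} (hs : s ∈ Set.Icc (0 : ℝ) 1) :
    ∫⁻ x in K, G ((1 - s / 2) • x + (s / 2) • y) ∂μ ≤
      ENNReal.ofReal (2 ^ Module.finrank ℝ E) * ∫⁻ x in K, G x ∂μ := by
  obtain ⟨hs0, hs1⟩ := hs
  have hr : (1 - s / 2) ≠ 0 := by linarith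
  have hGK : Measurable (K.indicator G) := hG.indicator hKm
  calc ∫⁻ x in K, G ((1 - s / 2) • x + (s / 2) • y) ∂μ
      ≤ ∫⁻ x, K.indicator G ((1 - s / 2) • x + (s / 2) • y) ∂μ := by
        rw [← lintegral_indicator hKm]
        refine lintegral_mono fun x => ?_
        by_cases hx : x ∈ K
        · have : (1 - s / 2) • x + (s / 2) • y ∈ K :=
            hK hx hy (by linarith) (by linarith) (by ring)
          simp [hx, this]
        · simp [hx]
    _ = ∫⁻ z, K.indicator G (z + (s / 2) • y) ∂(μ.map ((1 - s / 2) • ·)) := by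
        rw [lintegral_map (f := fun z => K.indicator G (z + (s / 2) • y))
          (hGK.comp (by fun_prop)) (by fun_prop)]
    _ = ENNReal.ofReal |((1 - s / 2) ^ Module.finrank ℝ E)⁻¹| * ∫⁻ x in K, G x ∂μ := by
        rw [Measure.map_addHaar_smul μ hr, lintegral_smul_measure,
          lintegral_add_right_eq_self (fun z => K.indicator G z), lintegral_indicator hKm,
          smul_eq_mul]
    _ ≤ _ := by
        gcongr
        rw [abs_of_nonneg (by have : (0 : ℝ) ≤ 1 - s / 2 := by linarith
                              positivity), ← inv_pow]
        refine pow_le_pow_left₀ (inv_nonneg.2 (by linarith)) ?_ _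
        rw [inv_le_comm₀ (by linarith) (by norm_num)]
        linarith

/-- By Tonelli, `x` can be integrated first with `s` and `y` fixed. Stopping at the midpoint keeps
the contraction ratio `1 - s / 2` at least `1 / 2`, so the Jacobian costs at most `2 ^ dim`. Along
the whole segment the factor `(1 - s) ^ (-dim)` would not be integrable in positive dimension. -/
lemma setLIntegral_sq_sub_midpoint_le {K : Set E} (hK : Convex ℝ K) (hKm : MeasurableSet K)
    {D : ℝ} (hD : ∀ x ∈ K, ∀ y ∈ K, ‖y - x‖ ≤ D) {f : E → ℝ} (hf : ContDiff ℝ 1 f)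
    {y : E} (hy : y ∈ K) :
    ∫⁻ x in K, ENNReal.ofReal ((f x - f ((1 / 2 : ℝ) • x + (1 / 2 : ℝ) • y)) ^ 2) ∂μ ≤
      ENNReal.ofReal ((D / 2) ^ 2) * (ENNReal.ofReal (2 ^ Module.finrank ℝ E) *
        ∫⁻ x in K, ENNReal.ofReal (‖fderiv ℝ f x‖ ^ 2) ∂μ) := by
  have hf' : Continuous (fderiv ℝ f) := hf.continuous_fderiv one_ne_zero
  set G : E → ℝ≥0∞ := fun x => ENNReal.ofReal (‖fderiv ℝ f x‖ ^ 2) with hGdef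
  have hGc : Continuous G := ENNReal.continuous_ofReal.comp (hf'.norm.pow 2)
  calc _ ≤ ∫⁻ x in K, ENNReal.ofReal ((D / 2) ^ 2) *
        (∫⁻ s in Set.Icc (0 : ℝ) 1, G ((1 - s / 2) • x + (s / 2) • y)) ∂μ := by
        refine setLIntegral_mono' hKm fun x hx => ?_
        have hcont2 : Continuous fun s : ℝ => ‖fderiv ℝ f ((1 - s / 2) • x + (s / 2) • y)‖ ^ 2 :=
          (hf'.comp (by fun_prop)).norm.pow 2
        have h1 := sq_sub_midpoint_le hf x y
        have h2 : (∫ s in (0 : ℝ)..1, ‖fderiv ℝ f ((1 - s / 2) • x + (s / 2) • y)‖ ^ 2)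
            = ∫ s in Set.Icc (0 : ℝ) 1, ‖fderiv ℝ f ((1 - s / 2) • x + (s / 2) • y)‖ ^ 2 := by
          rw [intervalIntegral.integral_of_le zero_le_one, integral_Icc_eq_integral_Ioc]
        rw [← ofReal_integral_eq_lintegral_ofReal
          (hcont2.continuousOn.integrableOn_compact isCompact_Icc)
          (ae_of_all _ fun s => sq_nonneg _), ← ENNReal.ofReal_mul (sq_nonneg _), ← h2]
        refine ENNReal.ofReal_le_ofReal (h1.trans ?_)
        have := hD x hx y hy
        gcongr
        exact intervalIntegral.integral_nonneg zero_le_one fun s _ => sq_nonneg _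
    _ = ENNReal.ofReal ((D / 2) ^ 2) * ∫⁻ s in Set.Icc (0 : ℝ) 1,
          ∫⁻ x in K, G ((1 - s / 2) • x + (s / 2) • y) ∂μ := by
        have hm : Measurable (Function.uncurry fun (x : E) (s : ℝ) =>
            G ((1 - s / 2) • x + (s / 2) • y)) :=
          (hGc.comp (by fun_prop)).measurable
        rw [lintegral_const_mul' _ _ ENNReal.ofReal_ne_top, lintegral_lintegral_swap hm.aemeasurable]
    _ ≤ ENNReal.ofReal ((D / 2) ^ 2) * ∫⁻ s in Set.Icc (0 : ℝ) 1,
          ENNReal.ofReal (2 ^ Module.finrank ℝ E) * ∫⁻ x in K, G x ∂μ := by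
        refine mul_le_mul_right ?_ _
        exact setLIntegral_mono' measurableSet_Icc fun s hs =>
          setLIntegral_comp_contraction_le hK hKm hGc.measurable hy hs
    _ = _ := by simp

/-- **Poincaré inequality on convex sets**: on a bounded convex set of positive finite volume, a
`C¹` function is close in `L²` to one of its values. -/
lemma exists_setLIntegral_sq_sub_le {K : Set E} (hK : Convex ℝ K) (hKm : MeasurableSet K)
    (h0 : μ K ≠ 0) (htop : μ K ≠ ⊤)
    {D : ℝ} (hD : ∀ x ∈ K, ∀ y ∈ K, ‖y - x‖ ≤ D) {f : E → ℝ} (hf : ContDiff ℝ 1 f) :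
    ∃ y ∈ K, ∫⁻ x in K, ENNReal.ofReal ((f x - f y) ^ 2) ∂μ ≤
      ENNReal.ofReal (D ^ 2 * 2 ^ Module.finrank ℝ E) *
        ∫⁻ x in K, ENNReal.ofReal (‖fderiv ℝ f x‖ ^ 2) ∂μ := by
  have hfc := hf.continuous
  set J := ENNReal.ofReal ((D / 2) ^ 2) * (ENNReal.ofReal (2 ^ Module.finrank ℝ E) *
        ∫⁻ x in K, ENNReal.ofReal (‖fderiv ℝ f x‖ ^ 2) ∂μ) with hJ
  set H : E → E → ℝ≥0∞ := fun x y =>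
    ENNReal.ofReal ((f x - f ((1 / 2 : ℝ) • x + (1 / 2 : ℝ) • y)) ^ 2) with hH
  have hHm : Measurable (Function.uncurry H) := by
    refine Continuous.measurable (ENNReal.continuous_ofReal.comp ?_)
    fun_prop
  have hHm' : Measurable (Function.uncurry fun x y => H y x) := hHm.comp measurable_swap
  have hm : Measurable (Function.uncurry fun y x : E => ENNReal.ofReal ((f x - f y) ^ 2)) := by
    refine Continuous.measurable (ENNReal.continuous_ofReal.comp ?_)
    fun_prop
  have hJle : ∀ y ∈ K, ∫⁻ x in K, H x y ∂μ ≤ J := fun y hy =>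
    setLIntegral_sq_sub_midpoint_le hK hKm hD hf hy
  -- Passing through the midpoint makes the two halves exchange under `x ↔ y`, so one estimate
  -- serves both.
  have hpt : ∀ x y, ENNReal.ofReal ((f x - f y) ^ 2) ≤ 2 * H x y + 2 * H y x := by
    intro x y
    simp only [hH]
    rw [show (2 : ℝ≥0∞) = ENNReal.ofReal 2 by simp, ← ENNReal.ofReal_mul zero_le_two,
      ← ENNReal.ofReal_mul zero_le_two, ← ENNReal.ofReal_add (by positivity) (by positivity),
      add_comm ((1 / 2 : ℝ) • y)]
    refine ENNReal.ofReal_le_ofReal ?_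
    nlinarith [sq_nonneg (f x - f ((1 / 2 : ℝ) • x + (1 / 2 : ℝ) • y) +
      (f y - f ((1 / 2 : ℝ) • x + (1 / 2 : ℝ) • y)))]
  have htot : ∫⁻ y in K, ∫⁻ x in K, ENNReal.ofReal ((f x - f y) ^ 2) ∂μ ∂μ ≤ 4 * J * μ K := by
    have hA : ∫⁻ y in K, ∫⁻ x in K, H x y ∂μ ∂μ ≤ J * μ K :=
      (setLIntegral_mono' hKm hJle).trans (by simp)
    calc _ ≤ ∫⁻ y in K, ∫⁻ x in K, (2 * H x y + 2 * H y x) ∂μ ∂μ :=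
          lintegral_mono fun y => lintegral_mono fun x => hpt x y
      _ = 2 * (∫⁻ y in K, ∫⁻ x in K, H x y ∂μ ∂μ) + 2 * ∫⁻ y in K, ∫⁻ x in K, H y x ∂μ ∂μ := by
          have e : ∀ y, ∫⁻ x in K, (2 * H x y + 2 * H y x) ∂μ
              = 2 * (∫⁻ x in K, H x y ∂μ) + 2 * ∫⁻ x in K, H y x ∂μ := by
            intro y
            rw [lintegral_add_left (f := fun x => 2 * H x y)
                ((hHm.comp (by fun_prop : Measurable fun x : E => (x, y))).const_mul 2),
              lintegral_const_mul' _ _ (by simp), lintegral_const_mul' _ _ (by simp)]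
          simp_rw [e]
          rw [lintegral_add_left, lintegral_const_mul' _ _ (by simp),
            lintegral_const_mul' _ _ (by simp)]
          exact (Measurable.lintegral_prod_right hHm').const_mul 2
      _ = 4 * ∫⁻ y in K, ∫⁻ x in K, H x y ∂μ ∂μ := by
          rw [lintegral_lintegral_swap (f := fun y x => H y x) hHm.aemeasurable, ← add_mul]
          norm_num
      _ ≤ 4 * (J * μ K) := by gcongr
      _ = _ := by ring
  -- Some `y` does no worse than the average over `K`, which is at most `4 * J`; the 4 then cancels
  -- the one in `(D / 2) ^ 2`.
  obtain ⟨y, hy, hle⟩ := exists_le_setLAverage (μ := μ) h0 htop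
    (Measurable.lintegral_prod_right (ν := μ.restrict K) hm).aemeasurable
  refine ⟨y, hy, hle.trans ?_⟩
  rw [setLAverage_eq]
  refine (ENNReal.div_le_of_le_mul htot).trans (le_of_eq ?_)
  rw [hJ, ENNReal.ofReal_mul (sq_nonneg _), div_pow, ENNReal.ofReal_div_of_pos (by norm_num),
    ← mul_assoc, ← mul_assoc]
  congr 2
  rw [show ENNReal.ofReal (2 ^ 2) = 4 by norm_num]
  exact ENNReal.mul_div_cancel (by norm_num) (by norm_num)

end ConvexPoincare

/-! ### Divergence theorem for radial fields. -/

section DivergenceTheorem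

variable {d : ℕ}

/-- The divergence theorem for the vector field `x ↦ h x • x`. -/
lemma integral_fderiv_apply_self {h : EuclideanSpace ℝ (Fin d) → ℝ} (hh : ContDiff ℝ 1 h)
    (hs : HasCompactSupport h) :
    ∫ x, fderiv ℝ h x x = - (d * ∫ x, h x) := by
  have hh' : Continuous (fderiv ℝ h) := hh.continuous_fderiv one_ne_zero
  let p : Fin d → EuclideanSpace ℝ (Fin d) →L[ℝ] ℝ := fun i => EuclideanSpace.proj i
  let e : Fin d → EuclideanSpace ℝ (Fin d) := fun i => EuclideanSpace.single i 1
  have hpe : ∀ i, p i (e i) = 1 := fun i => by simp [p, e]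
  have hint : ∀ i, Integrable fun x => p i x * fderiv ℝ h x (e i) := fun i =>
    Continuous.integrable_of_hasCompactSupport (by fun_prop)
      ((hs.fderiv_apply (𝕜 := ℝ) (e i)).mul_left)
  have hi : ∀ i, ∫ x, p i x * fderiv ℝ h x (e i) = - ∫ x, h x := by
    intro i
    have := integral_mul_fderiv_eq_neg_fderiv_mul_of_integrable (μ := volume)
      (f := fun x => p i x) (g := h) (v := e i) ?_ (hint i) ?_
      (fun x _ => (p i).differentiableAt) (fun x _ => hh.differentiable one_ne_zero x)
    · rw [this]
      congr 2 with x
      rw [ContinuousLinearMap.fderiv, hpe, one_mul]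
    · refine Continuous.integrable_of_hasCompactSupport ?_ hs.mul_left
      simp only [ContinuousLinearMap.fderiv]
      exact continuous_const.mul hh.continuous
    · exact Continuous.integrable_of_hasCompactSupport ((p i).continuous.mul hh.continuous)
        hs.mul_left
  have hx : ∀ x, fderiv ℝ h x x = ∑ i, p i x * fderiv ℝ h x (e i) := by
    intro x
    have : x = ∑ i, p i x • e i := by
      simpa [p, e] using ((EuclideanSpace.basisFun (Fin d) ℝ).sum_repr x).symm
    conv_lhs => rw [this]
    simp only [map_sum, map_smul, smul_eq_mul]
    rw [← this]
  simp_rw [hx]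
  rw [integral_finsetSum _ fun i _ => hint i]
  simp [hi]

end DivergenceTheorem

/-! ### Gibbs measures: integrability and integration by parts. -/

section Gibbs

variable {d : ℕ} {U : EuclideanSpace ℝ (Fin d) → ℝ}

lemma exists_quadratic_lower_bound (hU : Continuous U) (htail : HasQuadraticTail U) :
    ∃ α > 0, ∃ M, ∀ x, α * ‖x‖ ^ 2 - M ≤ U x := by
  obtain ⟨α, hα, R, hR, h⟩ := htail
  obtain ⟨M, hM⟩ := (isCompact_closedBall (0 : EuclideanSpace ℝ (Fin d)) R).bddAbove_image
    (f := fun x => α * ‖x‖ ^ 2 - U x) (by fun_prop)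
  refine ⟨α, hα, max M 0, fun x => ?_⟩
  by_cases hx : R < ‖x‖
  · linarith [h x hx, le_max_right M 0]
  · have := hM (Set.mem_image_of_mem _ (mem_closedBall_zero_iff.2 (not_lt.1 hx)))
    linarith [le_max_left M 0]

lemma integrable_exp_neg_mul (hU : Continuous U) (htail : HasQuadraticTail U) {b : ℝ}
    (hb : 0 < b) : Integrable fun x => Real.exp (-b * U x) := by
  obtain ⟨α, hα, M, h⟩ := exists_quadratic_lower_bound hU htail
  have hg : Integrable fun x : EuclideanSpace ℝ (Fin d) => Real.exp (-(b * α) * ‖x‖ ^ 2) := by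
    refine Integrable.of_integral_ne_zero ?_
    rw [GaussianFourier.integral_rexp_neg_mul_sq_norm (by positivity)]
    positivity
  refine (hg.const_mul (Real.exp (b * M))).mono' (by fun_prop) (ae_of_all _ fun x => ?_)
  rw [Real.norm_of_nonneg (Real.exp_pos _).le, ← Real.exp_add]
  refine Real.exp_le_exp.2 ?_
  nlinarith [h x]

lemma isProbabilityMeasure_gibbsMeasure (hU : Continuous U) (htail : HasQuadraticTail U) {b : ℝ}
    (hb : 0 < b) : IsProbabilityMeasure (gibbsMeasure U b) :=
  isProbabilityMeasure_tilted (integrable_exp_neg_mul hU htail hb)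

/-- The divergence theorem for `h = g² e^{-bU}`, divided by the partition function; the last term
comes from differentiating the weight. -/
lemma integral_gibbsMeasure_eq_zero (hU : ContDiff ℝ 1 U) (b : ℝ)
    {g : EuclideanSpace ℝ (Fin d) → ℝ} (hg : ContDiff ℝ 1 g) (hs : HasCompactSupport g) :
    ∫ x, (d * g x ^ 2 + 2 * (g x * fderiv ℝ g x x) - b * (g x ^ 2 * fderiv ℝ U x x))
      ∂(gibbsMeasure U b) = 0 := by
  set w : EuclideanSpace ℝ (Fin d) → ℝ := fun x => Real.exp (-b * U x) with hw
  have hwc : ContDiff ℝ 1 w := by fun_prop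
  have hgs : HasCompactSupport fun x => g x ^ 2 := by
    simpa only [sq] using! hs.mul_left (f := g)
  have hc : ContDiff ℝ 1 fun x => g x ^ 2 * w x := by fun_prop
  have hd : ∀ x, fderiv ℝ (fun x => g x ^ 2 * w x) x x
      = w x * (2 * (g x * fderiv ℝ g x x) - b * (g x ^ 2 * fderiv ℝ U x x)) := by
    intro x
    have h1 := (hg.differentiable one_ne_zero x).hasFDerivAt
    have h2 := (hU.differentiable one_ne_zero x).hasFDerivAt
    have h3 : HasFDerivAt w _ x := (h2.const_mul (-b)).exp
    rw [((h1.pow 2).fun_mul h3).fderiv]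
    simp [hw]
    ring
  have key := integral_fderiv_apply_self hc hgs.mul_right
  have hi1 : Integrable fun x => g x ^ 2 * w x :=
    hc.continuous.integrable_of_hasCompactSupport hgs.mul_right
  have hi2 : Integrable fun x => fderiv ℝ (fun x => g x ^ 2 * w x) x x := by
    have := hc.continuous_fderiv one_ne_zero
    refine Continuous.integrable_of_hasCompactSupport (by fun_prop) ?_
    refine (hgs.mul_right (f' := w)).fderiv (𝕜 := ℝ) |>.mono ?_
    intro x hx hx'
    exact hx (congrArg (fun L => L x) hx')
  have hsum : ∫ x, (d * (g x ^ 2 * w x) + fderiv ℝ (fun x => g x ^ 2 * w x) x x) = 0 := by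
    rw [integral_add (hi1.const_mul _) hi2, key, integral_const_mul]
    ring
  rw [gibbsMeasure, integral_tilted]
  calc _ = ∫ x, (∫ y, w y)⁻¹ * (d * (g x ^ 2 * w x) + fderiv ℝ (fun x => g x ^ 2 * w x) x x) := by
        congr 1 with x
        rw [hd, smul_eq_mul, div_eq_inv_mul]
        ring
    _ = 0 := by rw [integral_const_mul, hsum, mul_zero]

end Gibbs

/-! ### Lyapunov estimate and truncation. -/

section LyapunovEstimate

variable {d : ℕ} {U : EuclideanSpace ℝ (Fin d) → ℝ}

/-- Young's inequality, weighted so that with `c = b * α` and `t = g x` the cross term uses up only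
half of the confinement `b α g² |x|²`. -/
lemma two_mul_mul_apply_le {E : Type*} [NormedAddCommGroup E] [NormedSpace ℝ E] {c : ℝ}
    (hc : 0 < c) (t : ℝ) (ℓ : E →L[ℝ] ℝ) (x : E) :
    2 * (t * ℓ x) ≤ c / 2 * (t ^ 2 * ‖x‖ ^ 2) + 2 / c * ‖ℓ‖ ^ 2 := by
  have h1 : t * ℓ x ≤ |t| * (‖ℓ‖ * ‖x‖) := by
    refine (le_abs_self _).trans ?_
    rw [abs_mul, ← Real.norm_eq_abs (ℓ x)]
    exact mul_le_mul_of_nonneg_left (ContinuousLinearMap.le_opNorm _ _) (abs_nonneg _)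
  have h2 : 0 ≤ 2 / c * (c / 2 * (|t| * ‖x‖) - ‖ℓ‖) ^ 2 := by positivity
  have h3 : 2 / c * (c / 2 * (|t| * ‖x‖) - ‖ℓ‖) ^ 2
      = c / 2 * (|t| ^ 2 * ‖x‖ ^ 2) - 2 * (|t| * (‖ℓ‖ * ‖x‖)) + 2 / c * ‖ℓ‖ ^ 2 := by
    field_simp
    ring
  rw [sq_abs] at h3
  linarith

/-- **Lyapunov estimate**: for test functions, the `L²` norm under a Gibbs measure is controlled by
the Dirichlet form and the `L²` norm on a ball, uniformly in the inverse temperature. -/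
lemma exists_integral_sq_le (hU : ContDiff ℝ 1 U) (htail : HasQuadraticTail U)
    (hgrad : HasQuadraticGradient U) {β₀ : ℝ} (hβ₀ : 0 < β₀) :
    ∃ R > 0, ∃ C₁ > 0, ∃ C₂ > 0, ∀ b, β₀ ≤ b → ∀ g : EuclideanSpace ℝ (Fin d) → ℝ,
      ContDiff ℝ 1 g → HasCompactSupport g →
      ∫ x, g x ^ 2 ∂(gibbsMeasure U b) ≤ C₁ * ∫ x, ‖fderiv ℝ g x‖ ^ 2 ∂(gibbsMeasure U b) +
        C₂ * ∫ x in Metric.closedBall 0 R, g x ^ 2 ∂(gibbsMeasure U b) := by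
  obtain ⟨α, hα, R₀, hR₀, hgr⟩ := hgrad
  have hgr' : ∀ x : EuclideanSpace ℝ (Fin d), R₀ < ‖x‖ → α * ‖x‖ ^ 2 ≤ fderiv ℝ U x x := by
    intro x hx
    have := hgr x hx
    rwa [← InnerProductSpace.toDual_apply_apply, toDual_gradient] at this
  have hU' : Continuous (fderiv ℝ U) := hU.continuous_fderiv one_ne_zero
  -- Chosen so that `d + b α ≤ (b α / 2) |x|²` for `|x| > R` and all `b ≥ β₀`: the remaining half of
  -- the confinement absorbs the dimension term and leaves `-b α g²`.
  set R := max R₀ (Real.sqrt (2 * (d / (β₀ * α)) + 2)) with hR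
  have hRpos : 0 < R := lt_max_of_lt_left hR₀
  have hRsq : 2 * (d / (β₀ * α)) + 2 ≤ R ^ 2 := by
    rw [← Real.sq_sqrt (show 0 ≤ 2 * (d / (β₀ * α)) + 2 by positivity)]
    exact pow_le_pow_left₀ (Real.sqrt_nonneg _) (le_max_right _ _) 2
  obtain ⟨M₀, hM₀⟩ := (isCompact_closedBall (0 : EuclideanSpace ℝ (Fin d)) R).bddAbove_image
    (f := fun x => α * ‖x‖ ^ 2 - fderiv ℝ U x x) (by fun_prop)
  -- `M` measures how far the gradient condition may fail inside the ball.
  set M := max M₀ 0 with hM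
  have hM0 : 0 ≤ M := le_max_right _ _
  have hMle : ∀ x ∈ Metric.closedBall (0 : EuclideanSpace ℝ (Fin d)) R,
      α * ‖x‖ ^ 2 - fderiv ℝ U x x ≤ M := fun x hx =>
    (hM₀ (Set.mem_image_of_mem _ hx)).trans (le_max_left _ _)
  -- The coefficients obtained by dividing `hmain` by `b * α`, with `b` replaced by its lower bound
  -- `β₀`.
  refine ⟨R, hRpos, 2 / (β₀ * α) ^ 2, by positivity, 1 + M / α + d / (β₀ * α), by positivity,
    fun b hb g hg hs => ?_⟩
  have hb0 : 0 < b := hβ₀.trans_le hb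
  set B := Metric.closedBall (0 : EuclideanSpace ℝ (Fin d)) R with hB
  have := isProbabilityMeasure_gibbsMeasure hU.continuous htail hb0
  set μ := gibbsMeasure U b with hμ
  have hg' : Continuous (fderiv ℝ g) := hg.continuous_fderiv one_ne_zero
  have hgc := hg.continuous
  have hgs : HasCompactSupport fun x => g x ^ 2 := by
    simpa only [sq] using! hs.mul_left (f := g)
  have hgs' : HasCompactSupport fun x => ‖fderiv ℝ g x‖ ^ 2 :=
    (hs.fderiv ℝ).comp_left (g := fun L => ‖L‖ ^ 2) (by simp)
  have i1 : Integrable (fun x => g x ^ 2) μ :=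
    (hgc.pow 2).integrable_of_hasCompactSupport hgs
  have i2 : Integrable (fun x => ‖fderiv ℝ g x‖ ^ 2) μ :=
    (hg'.norm.pow 2).integrable_of_hasCompactSupport hgs'
  have i3 : Integrable (fun x => g x * fderiv ℝ g x x) μ :=
    Continuous.integrable_of_hasCompactSupport (by fun_prop) hs.mul_right
  have i4 : Integrable (fun x => g x ^ 2 * fderiv ℝ U x x) μ :=
    Continuous.integrable_of_hasCompactSupport (by fun_prop) hgs.mul_right
  have i5 : Integrable (B.indicator fun x => g x ^ 2) μ :=
    i1.indicator Metric.isClosed_closedBall.measurableSet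
  have hzero := integral_gibbsMeasure_eq_zero hU b hg hs
  rw [← hμ] at hzero
  have hpt : ∀ x, (d * g x ^ 2 + 2 * (g x * fderiv ℝ g x x) - b * (g x ^ 2 * fderiv ℝ U x x))
      ≤ 2 / (b * α) * ‖fderiv ℝ g x‖ ^ 2 + (d + b * α + b * M) * B.indicator (fun x => g x ^ 2) x
        - b * α * g x ^ 2 := by
    intro x
    have hyoung := two_mul_mul_apply_le (show 0 < b * α by positivity) (g x) (fderiv ℝ g x) x
    have hg2 := sq_nonneg (g x)
    by_cases hx : x ∈ B
    · rw [Set.indicator_of_mem hx]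
      have h1 : b * g x ^ 2 * (α * ‖x‖ ^ 2 - fderiv ℝ U x x) ≤ b * g x ^ 2 * M :=
        mul_le_mul_of_nonneg_left (hMle x hx) (by positivity)
      have h2 : 0 ≤ b * α / 2 * (g x ^ 2 * ‖x‖ ^ 2) := by positivity
      linarith
    · rw [Set.indicator_of_notMem hx]
      have hxR : R < ‖x‖ := by simpa [hB] using hx
      have h1 : b * g x ^ 2 * (α * ‖x‖ ^ 2) ≤ b * g x ^ 2 * fderiv ℝ U x x :=
        mul_le_mul_of_nonneg_left (hgr' x ((le_max_left _ _).trans_lt hxR)) (by positivity)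
      have h2 : 2 * (d / (β₀ * α)) + 2 ≤ ‖x‖ ^ 2 :=
        hRsq.trans (pow_le_pow_left₀ hRpos.le hxR.le 2)
      have h3 : (d : ℝ) ≤ b * α * (d / (β₀ * α)) := by
        rw [mul_div_assoc', le_div_iff₀ (by positivity), mul_comm]
        gcongr
      have h4 : d + b * α ≤ b * α / 2 * ‖x‖ ^ 2 := by
        have := mul_le_mul_of_nonneg_left h2 (show 0 ≤ b * α / 2 by positivity)
        linarith
      have h5 := mul_le_mul_of_nonneg_right h4 hg2
      linarith
  have j1 : Integrable (fun x => 2 / (b * α) * ‖fderiv ℝ g x‖ ^ 2) μ := i2.const_mul _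
  have j2 : Integrable (fun x => (d + b * α + b * M) * B.indicator (fun x => g x ^ 2) x) μ :=
    i5.const_mul _
  have j3 : Integrable (fun x => b * α * g x ^ 2) μ := i1.const_mul _
  have j12 : Integrable (fun x => 2 / (b * α) * ‖fderiv ℝ g x‖ ^ 2 +
      (d + b * α + b * M) * B.indicator (fun x => g x ^ 2) x) μ := j1.add j2
  have k12 : Integrable (fun x => d * g x ^ 2 + 2 * (g x * fderiv ℝ g x x)) μ :=
    (i1.const_mul (d : ℝ)).add (i3.const_mul 2)
  have hint := integral_mono (k12.sub (i4.const_mul b)) (j12.sub j3) hpt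
  have hmain : b * α * ∫ x, g x ^ 2 ∂μ ≤ 2 / (b * α) * ∫ x, ‖fderiv ℝ g x‖ ^ 2 ∂μ
        + (d + b * α + b * M) * ∫ x in B, g x ^ 2 ∂μ := by
    have h := hzero.symm.le.trans hint
    rw [integral_sub' j12 j3, integral_add j1 j2, integral_const_mul, integral_const_mul,
      integral_const_mul, integral_indicator Metric.isClosed_closedBall.measurableSet] at h
    linarith
  have hD : 0 ≤ ∫ x, ‖fderiv ℝ g x‖ ^ 2 ∂μ := integral_nonneg fun x => sq_nonneg _
  have hS : 0 ≤ ∫ x in B, g x ^ 2 ∂μ := integral_nonneg fun x => sq_nonneg _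
  calc ∫ x, g x ^ 2 ∂μ = (b * α * ∫ x, g x ^ 2 ∂μ) / (b * α) := by field_simp
    _ ≤ (2 / (b * α) * ∫ x, ‖fderiv ℝ g x‖ ^ 2 ∂μ
        + (d + b * α + b * M) * ∫ x in B, g x ^ 2 ∂μ) / (b * α) := by gcongr
    _ = 2 / (b * α) ^ 2 * ∫ x, ‖fderiv ℝ g x‖ ^ 2 ∂μ
        + (1 + M / α + d / (b * α)) * ∫ x in B, g x ^ 2 ∂μ := by
      field_simp
      ring
    _ ≤ _ := by gcongr

/-- Smooth cutoff functions with values in `[0, 1]` and uniformly bounded derivatives which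
eventually equal `1` near every point. -/
lemma exists_cutoff_sequence (E : Type*) [NormedAddCommGroup E] [InnerProductSpace ℝ E]
    [FiniteDimensional ℝ E] :
    ∃ (L : ℝ) (χ : ℕ → E → ℝ), 0 ≤ L ∧ (∀ n, ContDiff ℝ 1 (χ n)) ∧
      (∀ n, HasCompactSupport (χ n)) ∧ (∀ n x, 0 ≤ χ n x) ∧ (∀ n x, χ n x ≤ 1) ∧
      (∀ n x, ‖fderiv ℝ (χ n) x‖ ≤ L) ∧
      ∀ x, ∀ᶠ n in Filter.atTop, ∀ᶠ y in nhds x, χ n y = 1 := by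
  let χ : ContDiffBump (0 : E) := ⟨1, 2, one_pos, one_lt_two⟩
  have hχ : ContDiff ℝ 1 χ := χ.contDiff
  have hχs : HasCompactSupport χ := χ.hasCompactSupport
  obtain ⟨L, hL⟩ := (hχs.fderiv ℝ).exists_bound_of_continuous (hχ.continuous_fderiv one_ne_zero)
  -- The cutoffs are dilates `χ(x / (n + 1))`: scale factors at most 1 preserve the derivative
  -- bound, and the region where they equal 1 exhausts the space.
  have hr0 : ∀ n : ℕ, 0 < 1 / ((n : ℝ) + 1) := fun n => by positivity
  have hr1 : ∀ n : ℕ, 1 / ((n : ℝ) + 1) ≤ 1 := fun n => by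
    rw [div_le_one (by positivity)]
    linarith [(Nat.cast_nonneg n : (0 : ℝ) ≤ n)]
  refine ⟨L, fun n x => χ ((1 / ((n : ℝ) + 1)) • x), (norm_nonneg _).trans (hL 0), fun n => ?_,
    fun n => ?_, fun n x => χ.nonneg, fun n x => χ.le_one, fun n x => ?_, fun x => ?_⟩
  · exact hχ.comp (contDiff_const.smul contDiff_id)
  · exact hχs.comp_smul (hr0 n).ne'
  · have h1 : HasFDerivAt (fun y => χ ((1 / ((n : ℝ) + 1)) • y))
        ((fderiv ℝ χ ((1 / ((n : ℝ) + 1)) • x)).comp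
          ((1 / ((n : ℝ) + 1)) • ContinuousLinearMap.id ℝ E)) x :=
      HasFDerivAt.comp (g := χ) x (hχ.differentiable one_ne_zero _).hasFDerivAt
        ((hasFDerivAt_id x).const_smul _)
    rw [h1.fderiv, ContinuousLinearMap.comp_smul, ContinuousLinearMap.comp_id, norm_smul,
      Real.norm_of_nonneg (hr0 n).le]
    exact (mul_le_of_le_one_left (norm_nonneg _) (hr1 n)).trans (hL _)
  · have hrt : Filter.Tendsto (fun n : ℕ => ‖(1 / ((n : ℝ) + 1)) • x‖) Filter.atTop (nhds 0) := by
      have := (tendsto_one_div_add_atTop_nhds_zero_nat (𝕜 := ℝ)).smul_const x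
      simpa using this.norm
    filter_upwards [hrt.eventually_lt_const one_pos] with n hn
    have : ∀ᶠ y in nhds x, ‖(1 / ((n : ℝ) + 1)) • y‖ < 1 :=
      (continuous_const.smul continuous_id).norm.continuousAt.eventually_lt_const hn
    filter_upwards [this] with y hy
    exact χ.one_of_mem_closedBall (mem_closedBall_zero_iff.2 hy.le)

/-- The estimate of `exists_integral_sq_le` extends by truncation to functions which are constant
near infinity. -/
lemma exists_integral_sq_sub_le (hU : ContDiff ℝ 1 U) (htail : HasQuadraticTail U)
    (hgrad : HasQuadraticGradient U) {β₀ : ℝ} (hβ₀ : 0 < β₀) :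
    ∃ R > 0, ∃ C₁ > 0, ∃ C₂ > 0, ∀ b, β₀ ≤ b → ∀ f : EuclideanSpace ℝ (Fin d) → ℝ,
      ContDiff ℝ 1 f → HasCompactSupport f → ∀ c : ℝ,
      ∫ x, (f x - c) ^ 2 ∂(gibbsMeasure U b) ≤ C₁ * ∫ x, ‖fderiv ℝ f x‖ ^ 2 ∂(gibbsMeasure U b) +
        C₂ * ∫ x in Metric.closedBall 0 R, (f x - c) ^ 2 ∂(gibbsMeasure U b) := by
  obtain ⟨R, hR, C₁, hC₁, C₂, hC₂, H⟩ := exists_integral_sq_le hU htail hgrad hβ₀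
  refine ⟨R, hR, C₁, hC₁, C₂, hC₂, fun b hb f hf hs c => ?_⟩
  have := isProbabilityMeasure_gibbsMeasure hU.continuous htail (hβ₀.trans_le hb)
  set μ := gibbsMeasure U b
  obtain ⟨L, χ, hL0, hχ, hχs, hχ0, hχ1, hL, hnear⟩ :=
    exists_cutoff_sequence (EuclideanSpace ℝ (Fin d))
  obtain ⟨L', hL'⟩ := (hs.fderiv ℝ).exists_bound_of_continuous (hf.continuous_fderiv one_ne_zero)
  obtain ⟨N, hN⟩ := hs.exists_bound_of_continuous hf.continuous
  have hfc : ∀ x, |f x - c| ≤ N + |c| := fun x => (abs_sub _ _).trans (by simpa using hN x)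
  set g : ℕ → EuclideanSpace ℝ (Fin d) → ℝ := fun n x => χ n x * (f x - c) with hg
  have hgd : ∀ n, ContDiff ℝ 1 (g n) := fun n => (hχ n).mul (hf.sub contDiff_const)
  have hgs : ∀ n, HasCompactSupport (g n) := fun n => (hχs n).mul_right
  -- Equality on a neighbourhood, not just at `x`, makes the derivatives agree as well.
  replace hnear : ∀ x, ∀ᶠ n in Filter.atTop, g n =ᶠ[nhds x] fun y => f y - c := by
    intro x
    filter_upwards [hnear x] with n hn
    filter_upwards [hn] with y hy
    simp [g, hy]
  have hb1 : ∀ n x, ‖g n x‖ ≤ N + |c| := by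
    intro n x
    rw [hg, norm_mul, Real.norm_of_nonneg (hχ0 n x)]
    exact (mul_le_of_le_one_left (norm_nonneg _) (hχ1 n x)).trans (hfc x)
  have hb2 : ∀ n x, ‖fderiv ℝ (g n) x‖ ≤ L' + (N + |c|) * L := by
    intro n x
    have h1 := ((hχ n).differentiable one_ne_zero x).hasFDerivAt
    have h2 := (hf.differentiable one_ne_zero x).hasFDerivAt.sub_const c
    rw [hg, (h1.fun_mul h2).fderiv]
    refine (norm_add_le _ _).trans (add_le_add ?_ ?_)
    · rw [norm_smul, Real.norm_of_nonneg (hχ0 n x)]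
      exact (mul_le_of_le_one_left (norm_nonneg _) (hχ1 n x)).trans (hL' x)
    · rw [norm_smul, Real.norm_eq_abs]
      exact mul_le_mul (hfc x) (hL n x) (norm_nonneg _) ((abs_nonneg _).trans (hfc x))
  have t1 : ∀ ν : Measure (EuclideanSpace ℝ (Fin d)), IsFiniteMeasure ν →
      Filter.Tendsto (fun n => ∫ x, g n x ^ 2 ∂ν) Filter.atTop
        (nhds (∫ x, (f x - c) ^ 2 ∂ν)) := by
    intro ν hν
    refine tendsto_integral_of_dominated_convergence (fun _ => (N + |c|) ^ 2)
      (fun n => ((hgd n).continuous.pow 2).aestronglyMeasurable) (integrable_const _)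
      (fun n => ae_of_all _ fun x => ?_) (ae_of_all _ fun x => ?_)
    · rw [norm_pow]
      exact pow_le_pow_left₀ (norm_nonneg _) (hb1 n x) 2
    · refine tendsto_const_nhds.congr' ?_
      filter_upwards [hnear x] with n hn
      rw [hn.self_of_nhds]
  have t2 : Filter.Tendsto (fun n => ∫ x, ‖fderiv ℝ (g n) x‖ ^ 2 ∂μ) Filter.atTop
        (nhds (∫ x, ‖fderiv ℝ f x‖ ^ 2 ∂μ)) := by
    refine tendsto_integral_of_dominated_convergence (fun _ => (L' + (N + |c|) * L) ^ 2)
      (fun n => (((hgd n).continuous_fderiv one_ne_zero).norm.pow 2).aestronglyMeasurable)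
      (integrable_const _) (fun n => ae_of_all _ fun x => ?_) (ae_of_all _ fun x => ?_)
    · rw [norm_pow, norm_norm]
      exact pow_le_pow_left₀ (norm_nonneg _) (hb2 n x) 2
    · refine tendsto_const_nhds.congr' ?_
      filter_upwards [hnear x] with n hn
      rw [hn.fderiv_eq, fderiv_sub_const]
  exact le_of_tendsto_of_tendsto' (t1 μ inferInstance)
    ((t2.const_mul C₁).add ((t1 (μ.restrict (Metric.closedBall 0 R)) inferInstance).const_mul C₂))
    fun n => H b hb (g n) (hgd n) (hgs n)

end LyapunovEstimate

/-! ### Attainment of the Poincaré constant. -/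

section PoincareConstant

variable {d : ℕ}

/-- The infimum defining the Poincaré constant is attained. -/
lemma satisfiesPoincare_poincareConst {μ : Measure (EuclideanSpace ℝ (Fin d))}
    (h : poincareConst μ < ⊤) : SatisfiesPoincare μ (poincareConst μ).toReal := by
  intro f hf hs
  have hle : ∀ C : ℝ≥0, SatisfiesPoincare μ C → Var[f; μ] ≤ C * ∫ x, ‖∇ f x‖ ^ 2 ∂μ :=
    fun C hC => hC f hf hs
  have hI : 0 ≤ ∫ x, ‖∇ f x‖ ^ 2 ∂μ := integral_nonneg fun x => sq_nonneg _
  -- With zero energy, any admissible `C` forces zero variance. Otherwise the Rayleigh-type quotient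
  -- is a lower bound for all admissible `C`, hence for their infimum.
  rcases hI.eq_or_lt with h0 | hpos
  · obtain ⟨C, hC⟩ := iInf_lt_iff.1 h
    obtain ⟨hC, -⟩ := iInf_lt_iff.1 hC
    simpa [← h0] using hle C hC
  · rw [← div_le_iff₀ hpos]
    refine (ENNReal.ofReal_le_iff_le_toReal h.ne).1 (le_iInf₂ fun C hC => ?_)
    rw [← ENNReal.ofReal_coe_nnreal]
    exact ENNReal.ofReal_le_ofReal ((div_le_iff₀ hpos).2 (hle C hC))

lemma poincareConst_le_ofReal {μ : Measure (EuclideanSpace ℝ (Fin d))} {C : ℝ} (hC : 0 ≤ C)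
    (h : SatisfiesPoincare μ C) : poincareConst μ ≤ ENNReal.ofReal C :=
  iInf₂_le C.toNNReal (by rwa [Real.coe_toNNReal C hC])

end PoincareConstant

/-! ### From the local to the global Poincaré inequality. -/

section GibbsPoincare

variable {d : ℕ} {U : EuclideanSpace ℝ (Fin d) → ℝ}

lemma exists_setIntegral_closedBall_sq_sub_le {R : ℝ} (hR : 0 < R)
    {f : EuclideanSpace ℝ (Fin d) → ℝ} (hf : ContDiff ℝ 1 f) :
    ∃ c : ℝ, ∫ x in Metric.closedBall 0 R, (f x - c) ^ 2 ≤
      (2 * R) ^ 2 * 2 ^ Module.finrank ℝ (EuclideanSpace ℝ (Fin d)) *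
        ∫ x in Metric.closedBall 0 R, ‖fderiv ℝ f x‖ ^ 2 := by
  have hBc := isCompact_closedBall (0 : EuclideanSpace ℝ (Fin d)) R
  have hfc := hf.continuous
  have hf' : Continuous (fderiv ℝ f) := hf.continuous_fderiv one_ne_zero
  have hD : ∀ x ∈ Metric.closedBall (0 : EuclideanSpace ℝ (Fin d)) R,
      ∀ y ∈ Metric.closedBall (0 : EuclideanSpace ℝ (Fin d)) R, ‖y - x‖ ≤ 2 * R := fun x hx y hy =>
    (norm_sub_le _ _).trans (by
      linarith [mem_closedBall_zero_iff.1 hx, mem_closedBall_zero_iff.1 hy])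
  obtain ⟨y, -, hy⟩ := exists_setLIntegral_sq_sub_le (μ := volume) (convex_closedBall _ R)
    hBc.measurableSet (Metric.measure_closedBall_pos _ _ hR).ne' measure_closedBall_lt_top.ne hD hf
  have q1 : IntegrableOn (fun x => (f x - f y) ^ 2) (Metric.closedBall 0 R) :=
    ((hfc.sub continuous_const).pow 2).continuousOn.integrableOn_compact hBc
  have q2 : IntegrableOn (fun x => ‖fderiv ℝ f x‖ ^ 2) (Metric.closedBall 0 R) :=
    (hf'.norm.pow 2).continuousOn.integrableOn_compact hBc
  rw [← ofReal_integral_eq_lintegral_ofReal q1 (ae_of_all _ fun x => sq_nonneg _),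
    ← ofReal_integral_eq_lintegral_ofReal q2 (ae_of_all _ fun x => sq_nonneg _),
    ← ENNReal.ofReal_mul (by positivity)] at hy
  exact ⟨f y, (ENNReal.ofReal_le_ofReal_iff (mul_nonneg (by positivity)
    (integral_nonneg fun x => sq_nonneg _))).1 hy⟩

/-- Upper comparison of a Gibbs measure with Lebesgue measure on a compact set. -/
lemma setIntegral_gibbsMeasure_le (hU : Continuous U) {B : Set (EuclideanSpace ℝ (Fin d))}
    (hB : IsCompact B) {M : ℝ} (hM : ∀ x ∈ B, |U x| ≤ M) {b : ℝ} (hb : 0 < b)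
    {h : EuclideanSpace ℝ (Fin d) → ℝ} (hc : Continuous h) (h0 : ∀ x, 0 ≤ h x) :
    ∫ x in B, h x ∂(gibbsMeasure U b) ≤
      Real.exp (b * M) / (∫ x, Real.exp (-b * U x)) * ∫ x in B, h x := by
  rw [gibbsMeasure, setIntegral_tilted, ← integral_const_mul]
  have hZ : 0 ≤ ∫ x, Real.exp (-b * U x) := integral_nonneg fun x => (Real.exp_pos _).le
  refine setIntegral_mono_on ?_ ((hc.continuousOn.integrableOn_compact hB).const_mul _)
    hB.measurableSet fun x hx => ?_
  · exact (Continuous.continuousOn (by fun_prop)).integrableOn_compact hB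
  · rw [smul_eq_mul]
    refine mul_le_mul_of_nonneg_right (div_le_div_of_nonneg_right (Real.exp_le_exp.2 ?_) hZ) (h0 x)
    nlinarith [abs_le.1 (hM x hx)]

/-- Lower comparison of a Gibbs measure with Lebesgue measure on a compact set. -/
lemma setIntegral_le_gibbsMeasure (hU : Continuous U) (htail : HasQuadraticTail U)
    {B : Set (EuclideanSpace ℝ (Fin d))}
    (hB : IsCompact B) {M : ℝ} (hM : ∀ x ∈ B, |U x| ≤ M) {b : ℝ} (hb : 0 < b)
    {h : EuclideanSpace ℝ (Fin d) → ℝ} (hc : Continuous h) (h0 : ∀ x, 0 ≤ h x) :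
    ∫ x in B, h x ≤ Real.exp (b * M) * (∫ x, Real.exp (-b * U x)) *
      ∫ x in B, h x ∂(gibbsMeasure U b) := by
  rw [gibbsMeasure, setIntegral_tilted, ← integral_const_mul]
  have hZ : 0 < ∫ x, Real.exp (-b * U x) := integral_exp_pos (integrable_exp_neg_mul hU htail hb)
  set Z := ∫ x, Real.exp (-b * U x)
  refine setIntegral_mono_on (hc.continuousOn.integrableOn_compact hB) ?_
    hB.measurableSet fun x hx => ?_
  · exact (Continuous.continuousOn (by fun_prop)).integrableOn_compact hB
  · have e : Real.exp (b * M) * Z * (Real.exp (-b * U x) / Z) • h x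
        = Real.exp (b * M + -b * U x) * h x := by
      rw [Real.exp_add, smul_eq_mul]
      field_simp
    rw [e]
    refine le_mul_of_one_le_left (h0 x) (Real.one_le_exp_iff.2 ?_)
    nlinarith [abs_le.1 (hM x hx)]

/-- Local Poincaré inequality for Gibbs measures, obtained by comparison with Lebesgue measure. -/
lemma exists_setIntegral_gibbsMeasure_sq_sub_le (hU : ContDiff ℝ 1 U) (htail : HasQuadraticTail U)
    {R : ℝ} (hR : 0 < R) :
    ∃ C > 0, ∃ K > 0, ∀ b, 0 < b → ∀ f : EuclideanSpace ℝ (Fin d) → ℝ,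
      ContDiff ℝ 1 f → HasCompactSupport f → ∃ c : ℝ,
      ∫ x in Metric.closedBall 0 R, (f x - c) ^ 2 ∂(gibbsMeasure U b) ≤
        C * Real.exp (b * K) * ∫ x, ‖fderiv ℝ f x‖ ^ 2 ∂(gibbsMeasure U b) := by
  have hBc := isCompact_closedBall (0 : EuclideanSpace ℝ (Fin d)) R
  obtain ⟨M, hM⟩ := hBc.exists_bound_of_continuousOn hU.continuous.continuousOn
  have hM0 : 0 ≤ M := (norm_nonneg _).trans (hM 0 (Metric.mem_closedBall_self hR.le))
  obtain ⟨C, hC, hCf⟩ : ∃ C > 0, ∀ f : EuclideanSpace ℝ (Fin d) → ℝ, ContDiff ℝ 1 f →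
      ∃ c : ℝ, ∫ x in Metric.closedBall 0 R, (f x - c) ^ 2 ≤
        C * ∫ x in Metric.closedBall 0 R, ‖fderiv ℝ f x‖ ^ 2 :=
    ⟨_, by positivity, fun f hf => exists_setIntegral_closedBall_sq_sub_le hR hf⟩
  -- The two density comparisons contribute `e^{bM}` each; the extra 1 only ensures positivity of
  -- the rate when `M = 0`.
  refine ⟨C, by positivity, 2 * M + 1, by positivity, fun b hb f hf hs => ?_⟩
  have hf' : Continuous (fderiv ℝ f) := hf.continuous_fderiv one_ne_zero
  have := isProbabilityMeasure_gibbsMeasure hU.continuous htail hb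
  obtain ⟨c, hc⟩ := hCf f hf
  have hs' : HasCompactSupport fun x => ‖fderiv ℝ f x‖ ^ 2 :=
    (hs.fderiv ℝ).comp_left (g := fun L => ‖L‖ ^ 2) (by simp)
  have i2 : Integrable (fun x => ‖fderiv ℝ f x‖ ^ 2) (gibbsMeasure U b) :=
    (hf'.norm.pow 2).integrable_of_hasCompactSupport hs'
  have hup := setIntegral_gibbsMeasure_le (h := fun x => (f x - c) ^ 2) hU.continuous hBc hM hb
    ((hf.continuous.sub continuous_const).pow 2) fun x => sq_nonneg (f x - c)
  have hlow := setIntegral_le_gibbsMeasure (h := fun x => ‖fderiv ℝ f x‖ ^ 2) hU.continuous htail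
    hBc hM hb (hf'.norm.pow 2) fun x => sq_nonneg _
  have hle := setIntegral_le_integral (s := Metric.closedBall 0 R) i2
    (ae_of_all _ fun x => sq_nonneg _)
  have hZ : 0 < ∫ x, Real.exp (-b * U x) :=
    integral_exp_pos (integrable_exp_neg_mul hU.continuous htail hb)
  have hD : 0 ≤ ∫ x, ‖fderiv ℝ f x‖ ^ 2 ∂(gibbsMeasure U b) := integral_nonneg fun x => sq_nonneg _
  refine ⟨c, ?_⟩
  set Z := ∫ x, Real.exp (-b * U x)
  set D := ∫ x, ‖fderiv ℝ f x‖ ^ 2 ∂(gibbsMeasure U b)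
  have hE := (Real.exp_pos (b * M)).le
  have h1 := hlow.trans (mul_le_mul_of_nonneg_left hle (mul_nonneg hE hZ.le))
  have h2 := hc.trans (mul_le_mul_of_nonneg_left h1 hC.le)
  have h3 := hup.trans (mul_le_mul_of_nonneg_left h2 (div_nonneg hE hZ.le))
  refine h3.trans ?_
  have e : Real.exp (b * M) / Z * (C * (Real.exp (b * M) * Z * D))
      = C * Real.exp (b * M + b * M) * D := by
    rw [Real.exp_add]
    field_simp
  rw [e]
  gcongr
  linarith

lemma exists_satisfiesPoincare_gibbsMeasure (hU : ContDiff ℝ 1 U) (htail : HasQuadraticTail U)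
    (hgrad : HasQuadraticGradient U) {β₀ : ℝ} (hβ₀ : 0 < β₀) :
    ∃ A > 0, ∃ B > 0, ∃ K > 0, ∀ b, β₀ ≤ b →
      SatisfiesPoincare (gibbsMeasure U b) (A * (1 + B * Real.exp (b * K))) := by
  obtain ⟨R, hR, C₁, hC₁, C₂, hC₂, H⟩ := exists_integral_sq_sub_le hU htail hgrad hβ₀
  obtain ⟨C₃, hC₃, K, hK, H'⟩ := exists_setIntegral_gibbsMeasure_sq_sub_le hU htail hR
  refine ⟨C₁, hC₁, C₂ * C₃ / C₁, by positivity, K, hK, fun b hb f hf hs => ?_⟩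
  have := isProbabilityMeasure_gibbsMeasure hU.continuous htail (hβ₀.trans_le hb)
  have hf1 : ContDiff ℝ 1 f := hf.of_le (by exact_mod_cast le_top)
  obtain ⟨c, hc⟩ := H' b (hβ₀.trans_le hb) f hf1 hs
  have hfc := hf.continuous
  have hgradient : ∀ x, ‖∇ f x‖ = ‖fderiv ℝ f x‖ := fun x => LinearIsometryEquiv.norm_map _ _
  simp_rw [hgradient]
  calc Var[f; gibbsMeasure U b] = Var[fun x => f x - c; gibbsMeasure U b] :=
        (variance_sub_const hfc.aestronglyMeasurable c).symm
    _ ≤ ∫ x, (f x - c) ^ 2 ∂(gibbsMeasure U b) :=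
        variance_le_expectation_sq (hfc.sub continuous_const).aestronglyMeasurable
    _ ≤ _ := H b hb f hf1 hs c
    _ ≤ C₁ * ∫ x, ‖fderiv ℝ f x‖ ^ 2 ∂(gibbsMeasure U b) +
        C₂ * (C₃ * Real.exp (b * K) * ∫ x, ‖fderiv ℝ f x‖ ^ 2 ∂(gibbsMeasure U b)) := by gcongr
    _ = _ := by field_simp

end GibbsPoincare

theorem mainTheorem8 {d : ℕ} (U : EuclideanSpace ℝ (Fin d) → ℝ)
    (hmin : HasCompactMinimizers U) (htail : HasQuadraticTail U)
    (hgrad : HasQuadraticGradient U) :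
    (∀ (T : ℝ) (β : ℝ → ℝ), (∀ t ∈ Set.Icc 0 T, 0 < β t) →
      ∀ t ∈ Set.Icc 0 T,
        IsProbabilityMeasure (gibbsMeasure U (β t)) ∧
        poincareConst (gibbsMeasure U (β t)) < ⊤ ∧
        SatisfiesPoincare (gibbsMeasure U (β t))
          (poincareConst (gibbsMeasure U (β t))).toReal) ∧
    (∀ β₀ : ℝ, 0 < β₀ → ∃ A > (0 : ℝ), ∃ B > (0 : ℝ), ∃ K > (0 : ℝ),
      ∀ (T : ℝ) (β : ℝ → ℝ), (∀ t ∈ Set.Icc 0 T, β₀ ≤ β t) →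
        ∀ t ∈ Set.Icc 0 T,
          poincareConst (gibbsMeasure U (β t)) ≤
            ENNReal.ofReal (A * (1 + B * Real.exp (β t * K)))) := by
  have hU := hmin.contDiff
  have bound : ∀ β₀ : ℝ, 0 < β₀ → ∃ A > (0 : ℝ), ∃ B > (0 : ℝ), ∃ K > (0 : ℝ), ∀ b, β₀ ≤ b →
      poincareConst (gibbsMeasure U b) ≤ ENNReal.ofReal (A * (1 + B * Real.exp (b * K))) := by
    intro β₀ hβ₀
    obtain ⟨A, hA, B, hB, K, hK, h⟩ := exists_satisfiesPoincare_gibbsMeasure hU htail hgrad hβ₀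
    exact ⟨A, hA, B, hB, K, hK, fun b hb => poincareConst_le_ofReal (by positivity) (h b hb)⟩
  refine ⟨fun T β hβ t ht => ?_, fun β₀ hβ₀ => ?_⟩
  -- For a single time no uniform lower bound is needed: `β t` itself serves as `β₀`.
  · obtain ⟨A, -, B, -, K, -, h⟩ := bound (β t) (hβ t ht)
    have hfin := (h (β t) le_rfl).trans_lt ENNReal.ofReal_lt_top
    exact ⟨isProbabilityMeasure_gibbsMeasure hU.continuous htail (hβ t ht), hfin,
      satisfiesPoincare_poincareConst hfin⟩
  · obtain ⟨A, hA, B, hB, K, hK, h⟩ := bound β₀ hβ₀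
    exact ⟨A, hA, B, hB, K, hK, fun T β hβ t ht => h (β t) (hβ t ht)⟩
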